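/- Let $\mathcal H$ be a real Hilbert space, $\mathcal A\subset\mathcal H$ a compact set, and $f:\mathcal H\to\mathbb R$. Suppose that for some $L,\mu>0$ the function $f$ is $L$-smooth over $\mathrm{conv}(\mathcal A)$ (differentiable at its points, with $f(y)\le f(x)+\langle\nabla f(x),y-x\rangle+\frac L2\|y-x\|^2$ for all $x,y\in\mathrm{conv}(\mathcal A)$; this holds in particular if $\nabla f$ is $L$-Lipschitz on $\mathrm{conv}(\mathcal A)$) and $\mu$-strongly convex on $\mathrm{conv}(\mathcal A)$. Let $q^\star$ be a minimizer of $f$ over $\mathrm{conv}(\mathcal A)$ and let $\delta\in(0,1]$. *Pyramidal width.* Call a finite set $S$ an active set of $x$ if $x$ is a convex combination of all elements of $S$ with strictly positive weights. For $\mathcal B\subseteq\mathcal H$ and $r\ne0$ put $$PdirW(\mathcal B,r,x)=\min_{S\subseteq\mathcal B\text{ active set of }x}\ \max_{s\in\mathcal B,\,v\in S}\Big\langle \tfrac{r}{\|r\|},s-v\Big\rangle ,\qquad \mathrm{PWidth}(\mathcal A)=\inf_{\substack{K\text{ face of }\mathrm{conv}(\mathcal A),\ x\in K\\ r\in\mathrm{cone}(K-x)\setminus\{0\}}}PdirW(K\cap\mathcal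 A,r,x),$$ where minima and maxima that are not attained are read as infima and suprema. The pyramidal width of a set with at most one point is $0$. *Algorithm (Norm-Corrective Frank-Wolfe).* Start from an atom $q^0\in\mathcal A$ with $S_0=\{q^0\}$. For $t=0,1,2,\dots$: choose any $z_t\in\mathcal A$ with $\langle\nabla f(q^t),z_t-q^t\rangle\le\delta\min_{s\in\mathcal A}\langle\nabla f(q^t),s-q^t\rangle$ (approximate linear minimization oracle); set $S_{t+1}=S_t\cup\{z_t\}$; and update - Variant 0: $q^{t+1}=\arg\min_{z\in\mathrm{conv}(S_{t+1})}\|z-b_t\|^2$ with $b_t=q^t-\frac1L\nabla f(q^t)$; - Variant 1: $q^{t+1}\in\arg\min_{z\in\mathrm{conv}(S_{t+1})}f(z)$. For Variant 0, write $q^t$ and $q^{t+1}$ as convex combinations of atoms of $S_t$ and $S_{t+1}$. Let $v_t$ be an away atom, i.e. a maximizer of $\langle\nabla f(q^t),\cdot\rangle$ over the atoms with positive weight in $q^t$ (or over all of $S_t$, or over any set between these two). Step $t$ is a *good step* if, for some choice of these combinations and of $v_t$, the atom $v_t$ keeps a positive weight in $q^{t+1}$. **Theorem.** Let $\varepsilon_t=f(q^t)-f(q^\star)$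 and $$\beta=\delta^2\,\frac{\mu\,\mathrm{PWidth}(\mathcal A)^2}{L\,\mathrm{diam}(\mathcal A)^2}\qquad(\beta:=0\text{ if }\mathcal A\text{ is a single point}).$$ Then: 1. $\beta\in[0,1]$; moreover $\beta>0$ whenever $\mathrm{PWidth}(\mathcal A)>0$, and $\mathrm{PWidth}(\mathcal A)>0$ whenever $\mathcal A$ is finite with at least two points. 2. Every run of Variant 1 satisfies $\varepsilon_{t+1}\le(1-\beta)\,\varepsilon_t$ for all $t\ge0$. 3. Every run of Variant 0 satisfies $\varepsilon_{t+1}\le(1-\beta)\,\varepsilon_t$ at every good step $t\ge0$. -/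

import Mathlib

namespace NormCorrective

noncomputable section

variable {H : Type*} [NormedAddCommGroup H] [InnerProductSpace ℝ H]

/-- `x` is a proper convex combination of all the elements of the finite set `S`:
`x = ∑ s ∈ S, w s • s` with all weights strictly positive and summing to one. -/
def IsActiveSet (S : Finset H) (x : H) : Prop :=
  ∃ w : H → ℝ, (∀ s ∈ S, 0 < w s) ∧ ∑ s ∈ S, w s = 1 ∧ ∑ s ∈ S, w s • s = x

/-- The pyramidal directional width of `B` with respect to the direction `r` and the base
point `x`: the minimum, over all `S ⊆ B` of which `x` is a proper convex combination, of
`max_{s ∈ B, v ∈ S} ⟪r / ‖r‖, s - v⟫`. -/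
def pdirW (B : Set H) (r x : H) : ℝ :=
  sInf {c : ℝ | ∃ S : Finset H, (S : Set H) ⊆ B ∧ IsActiveSet S x ∧
    c = sSup {d : ℝ | ∃ s ∈ B, ∃ v ∈ S, d = inner ℝ (‖r‖⁻¹ • r) (s - v)}}

/-- `K` is a face of the convex set `C`. -/
def IsFace (C K : Set H) : Prop :=
  IsExtreme ℝ C K ∧ Convex ℝ K

/-- The pyramidal width of `A`: the infimum of `pdirW (K ∩ A) r x` over the faces `K` of
`conv A`, the points `x ∈ K` and the nonzero directions `r` in the cone generated by `K - x`
(as `K` is convex and contains `x`, that cone consists of the vectors `c • (y - x)` with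
`y ∈ K` and `c ≥ 0`). -/
def pyramidalWidth (A : Set H) : ℝ :=
  sInf {p : ℝ | ∃ K : Set H, IsFace (convexHull ℝ A) K ∧ ∃ x ∈ K, ∃ y ∈ K, ∃ c : ℝ, 0 ≤ c ∧
    ∃ r : H, r = c • (y - x) ∧ r ≠ 0 ∧ p = pdirW (K ∩ A) r x}

variable [CompleteSpace H]

/-- `f` is `L`-smooth over `C`: it is differentiable at the points of `C` and satisfies there
the quadratic upper bound with constant `L`. -/
def IsSmoothOver (L : ℝ) (f : H → ℝ) (C : Set H) : Prop :=
  (∀ x ∈ C, DifferentiableAt ℝ f x) ∧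
    ∀ x ∈ C, ∀ y ∈ C, f y ≤ f x + inner ℝ (gradient f x) (y - x) + L / 2 * ‖y - x‖ ^ 2

/-- `z` is an admissible answer, at the current iterate `q`, of a linear minimization oracle
over `A` with relative accuracy `δ`: `⟪g, z - q⟫ ≤ δ * min_{s ∈ A} ⟪g, s - q⟫`.
(For `A` compact and nonempty and `δ ≥ 0` the minimum is attained, so the inequality for the
minimum is the inequality for all `s ∈ A`.) -/
def IsApproxLMO (A : Set H) (δ : ℝ) (g q z : H) : Prop :=
  z ∈ A ∧ ∀ s ∈ A, inner ℝ g (z - q) ≤ δ * inner ℝ g (s - q)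

/-- Variant 0 of the update: `q'` is a point of `conv S` closest to `b = q - (1 / L) • ∇ f q`. -/
def NormUpdate (f : H → ℝ) (L : ℝ) (S : Set H) (q q' : H) : Prop :=
  q' ∈ convexHull ℝ S ∧
    IsMinOn (fun z => ‖z - (q - (1 / L) • gradient f q)‖ ^ 2) (convexHull ℝ S) q'

/-- Variant 1 of the update: `q'` is a minimizer of `f` over `conv S`. -/
def FullUpdate (f : H → ℝ) (S : Set H) (_q q' : H) : Prop :=
  q' ∈ convexHull ℝ S ∧ IsMinOn f (convexHull ℝ S) q'

/-- `q`, `z`, `S` are the iterates, the oracle answers and the sets of collected atoms of a run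
of the algorithm with the given update rule, started at an atom. -/
structure IsRun (update : Set H → H → H → Prop) (f : H → ℝ) (A : Set H) (δ : ℝ)
    (q z : ℕ → H) (S : ℕ → Set H) : Prop where
  init_mem : q 0 ∈ A
  init_atoms : S 0 = {q 0}
  oracle : ∀ t, IsApproxLMO A δ (gradient f (q t)) (q t) (z t)
  atoms : ∀ t, S (t + 1) = S t ∪ {z t}
  step : ∀ t, update (S (t + 1)) (q t) (q (t + 1))

/-- The step from `q` (with atoms `S`) to `q'` (with atoms `S'`) is a good step: the away atom
`v` keeps a positive weight in `q'`. Here `B` and `B'` are the atoms that have positive weight in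
`q` and in `q'`, and `v` maximizes `⟪∇ f q, ·⟫`, either over all the collected atoms (`U = S`) or
only over the active ones (`U = B`), or over any set of atoms between these two. -/
def IsGoodStep (f : H → ℝ) (S S' : Set H) (q q' : H) : Prop :=
  ∃ B B' : Finset H, IsActiveSet B q ∧ IsActiveSet B' q' ∧ (B' : Set H) ⊆ S' ∧
    ∃ U : Set H, (B : Set H) ⊆ U ∧ U ⊆ S ∧
      ∃ v ∈ U, IsMaxOn (fun s => inner ℝ (gradient f q) s) U v ∧ v ∈ B'

/-- The rate constant `δ² μ PWidth(A)² / (L diam(A)²)`. -/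
def rate (A : Set H) (L μ δ : ℝ) : ℝ :=
  δ ^ 2 * (μ * pyramidalWidth A ^ 2 / (L * Metric.diam A ^ 2))

end

end NormCorrective

/-! Write `w` for the pyramidal width, `D` for the diameter, `a = ⟪-∇f(q), q* - q⟫` and `ρ = ‖q* -
q‖`. Strong convexity gives `ε ≤ a - μρ²/2`. If a step guarantees `f q' ≤ f q - γG + Lγ²D²/2` for
all `γ ∈ [0, 1]`, and if `w a ≤ ρ G / δ`, then `γ = δμwρ/(LD²)` yields `ε' ≤ (1 - β) ε`
(`sub_le_rate_mul_of_progress`).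

The geometric input is `pyramidalWidth_mul_inner_le`. For `r = -∇f(q)`, split `r = p + n` with `p`
the projection onto the cone of feasible directions at `q` and `n` normal to `conv A` at `q`. The
face exposed by `n` contains every active set of `q`, and on it `r` and `p` have the same
differences, so the width applies to the feasible direction `p`; moreover `⟪r, q* - q⟫ ≤ ‖p‖ ρ`.

The projection must lie in the cone itself, so the cone has to be closed. This holds for polytopes,
and a compact `A` with `w > 0` always has a polytope as its hull (`exists_finset_convexHull_eq`):
points of `A` farthest from some center are `w`-separated, hence finitely many, and they span the
hull. When `w = 0` only monotonicity of `f` is needed.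

In Variant 1 the gradient is constant on the active atoms and the segment from `q` to `z` gives the
progress. In Variant 0 the quadratic model at `q'` is at least as good as along the pairwise
direction `z - v`, because a good step makes the optimality inequality an equality at `v`. -/

namespace NormCorrective

/-! ### Finitely generated cones: bounded coefficients and closedness. -/

section Cone

variable {E : Type*} [NormedAddCommGroup E] [NormedSpace ℝ E]

/-- The cone generated by a finite set of vectors. -/
def finiteCone (D : Finset E) : Set E :=
  {r | ∃ c : E → ℝ, (∀ d ∈ D, 0 ≤ c d) ∧ ∑ d ∈ D, c d • d = r}

/-- Linearly independent vectors: the coefficients of a conic combination are bounded by its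
norm. -/
theorem exists_sum_coeff_le_of_linearIndepOn {D : Finset E} (hD : LinearIndepOn ℝ id (D : Set E)) :
    ∃ M : ℝ, 0 ≤ M ∧ ∀ c : E → ℝ, ∑ d ∈ D, c d ≤ M * ‖∑ d ∈ D, c d • d‖ := by
  have hinj : Function.Injective (Fintype.linearCombination ℝ (fun d : D => (d : E))) :=
    linearIndependent_iff_injective_fintypeLinearCombination.1 hD
  obtain ⟨K, -, hK⟩ := (LinearMap.injective_iff_antilipschitz _).1 hinj
  refine ⟨D.card * K, by positivity, fun c => ?_⟩
  have h1 := hK.le_mul_dist (fun d : D => c d) 0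
  simp only [dist_zero_right, map_zero, Fintype.linearCombination_apply] at h1
  rw [Finset.sum_coe_sort D (fun d => c d • d)] at h1
  have h2 : ∀ d ∈ D, c d ≤ K * ‖∑ d ∈ D, c d • d‖ := fun d hd =>
    (le_abs_self _).trans ((norm_le_pi_norm (fun d : D => c d) ⟨d, hd⟩).trans h1)
  calc ∑ d ∈ D, c d ≤ ∑ _d ∈ D, K * ‖∑ d ∈ D, c d • d‖ := Finset.sum_le_sum h2
    _ = D.card * K * ‖∑ d ∈ D, c d • d‖ := by simp [mul_assoc]

/-- The reduction step of Carathéodory's theorem for cones. -/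
theorem exists_coeff_eq_zero_of_not_linearIndepOn {D : Finset E}
    (hD : ¬ LinearIndepOn ℝ id (D : Set E)) {c : E → ℝ} (hc : ∀ d ∈ D, 0 ≤ c d) :
    ∃ c' : E → ℝ, (∀ d ∈ D, 0 ≤ c' d) ∧ ∑ d ∈ D, c' d • d = ∑ d ∈ D, c d • d ∧
      ∃ d ∈ D, c' d = 0 := by
  classical
  obtain ⟨g, hg, e, he, hge⟩ : ∃ g : E → ℝ, ∑ d ∈ D, g d • d = 0 ∧ ∃ e ∈ D, 0 < g e := by
    rw [linearIndepOn_finset_iff] at hD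
    push Not at hD
    obtain ⟨g, hg, e, he, hge⟩ := hD
    rcases lt_or_gt_of_ne hge with h | h
    · refine ⟨fun d => - g d, ?_, e, he, by simpa using h⟩
      simpa [neg_smul, Finset.sum_neg_distrib] using hg
    · exact ⟨g, by simpa using hg, e, he, h⟩
  -- Ratio test: subtracting the smallest ratio `c m / g m` times the relation `g` keeps all
  -- coefficients nonnegative and cancels the one at `m`.
  obtain ⟨m, hm, hmin⟩ := Finset.exists_min_image (D.filter fun d => 0 < g d)
    (fun d => c d / g d) ⟨e, Finset.mem_filter.2 ⟨he, hge⟩⟩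
  obtain ⟨hmD, hgm⟩ := Finset.mem_filter.1 hm
  refine ⟨fun d => c d - c m / g m * g d, fun d hd => ?_, ?_, m, hmD, ?_⟩
  · rcases lt_or_ge 0 (g d) with h | h
    · have := hmin d (Finset.mem_filter.2 ⟨hd, h⟩)
      have h3 := mul_le_mul_of_nonneg_right this h.le
      rw [div_mul_cancel₀ _ h.ne'] at h3
      linarith
    · have := mul_nonpos_of_nonneg_of_nonpos (div_nonneg (hc m hmD) hgm.le) h
      linarith [hc d hd]
  · simp only [sub_smul, Finset.sum_sub_distrib, mul_smul, ← Finset.smul_sum, hg, smul_zero,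
      sub_zero]
  · simp only []
    rw [div_mul_cancel₀ _ hgm.ne', sub_self]

/-- Every element of a finitely generated cone is a conic combination of the generators with
coefficients bounded by a fixed multiple of its norm. -/
theorem exists_bounded_coeff (D : Finset E) :
    ∃ M : ℝ, 0 ≤ M ∧ ∀ r ∈ finiteCone D, ∃ c : E → ℝ, (∀ d ∈ D, 0 ≤ c d) ∧
      ∑ d ∈ D, c d • d = r ∧ ∑ d ∈ D, c d ≤ M * ‖r‖ := by
  classical
  induction hn : D.card using Nat.strong_induction_on generalizing D with
  | _ n ih =>
  by_cases hD : LinearIndepOn ℝ id (D : Set E)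
  · obtain ⟨M, hM0, hM⟩ := exists_sum_coeff_le_of_linearIndepOn hD
    refine ⟨M, hM0, ?_⟩
    rintro r ⟨c, hc, rfl⟩
    exact ⟨c, hc, rfl, hM c⟩
  have key : ∀ d : E, ∃ M : ℝ, 0 ≤ M ∧ (d ∈ D → ∀ r ∈ finiteCone (D.erase d), ∃ c : E → ℝ,
      (∀ e ∈ D.erase d, 0 ≤ c e) ∧ ∑ e ∈ D.erase d, c e • e = r ∧
        ∑ e ∈ D.erase d, c e ≤ M * ‖r‖) := by
    intro d
    by_cases hd : d ∈ D
    · obtain ⟨M, hM0, hM⟩ := ih _ (hn ▸ Finset.card_erase_lt_of_mem hd) (D.erase d) rfl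
      exact ⟨M, hM0, fun _ => hM⟩
    · exact ⟨0, le_rfl, fun h => absurd h hd⟩
  choose M hM0 hM using key
  -- The generator to be dropped depends on `r`; the sum dominates every `M d` at once.
  refine ⟨∑ d ∈ D, M d, Finset.sum_nonneg fun d _ => hM0 d, ?_⟩
  rintro r ⟨c, hc, rfl⟩
  obtain ⟨c', hc', hsum, m, hm, hcm⟩ := exists_coeff_eq_zero_of_not_linearIndepOn hD hc
  rw [← hsum]
  obtain ⟨b, hb, hbs, hbM⟩ := hM m hm (∑ d ∈ D, c' d • d) ⟨c', fun e he =>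
    hc' e (Finset.mem_of_mem_erase he), by
      rw [← Finset.add_sum_erase D (fun d => c' d • d) hm, hcm, zero_smul, zero_add]⟩
  have h0 : ∀ e ∈ D.erase m, Function.update b m 0 e = b e := fun e he => by
    rw [Function.update_of_ne (Finset.ne_of_mem_erase he)]
  refine ⟨Function.update b m 0, fun d hd => ?_, ?_, ?_⟩
  · by_cases h : d = m
    · simp [h]
    · have hd' := Finset.mem_erase.2 ⟨h, hd⟩
      rw [h0 d hd']
      exact hb d hd'
  · rw [← Finset.add_sum_erase D _ hm, Function.update_self, zero_smul, zero_add, ← hbs]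
    exact Finset.sum_congr rfl fun e he => by rw [h0 e he]
  · rw [← Finset.add_sum_erase D _ hm, Function.update_self, zero_add,
      Finset.sum_congr rfl h0]
    refine hbM.trans (mul_le_mul_of_nonneg_right ?_ (norm_nonneg _))
    exact Finset.single_le_sum (f := M) (fun d _ => hM0 d) hm

/-- By the coefficient bound, the part of the cone in a unit ball around `x` lies in the image of a
compact box of coefficients, which is a closed subset of the cone. -/
theorem isClosed_finiteCone (D : Finset E) : IsClosed (finiteCone D) := by
  obtain ⟨M, hM0, hM⟩ := exists_bounded_coeff D
  refine isClosed_of_closure_subset fun x hx => ?_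
  set R : ℝ := M * (‖x‖ + 1)
  let φ : (D → ℝ) → E := fun c => ∑ d : D, c d • (d : E)
  have hφ : Continuous φ := by fun_prop
  have hbox : IsCompact (φ '' Set.Icc 0 (fun _ => R)) := isCompact_Icc.image hφ
  have hsub : φ '' Set.Icc 0 (fun _ => R) ⊆ finiteCone D := by
    classical
    rintro _ ⟨c, hc, rfl⟩
    refine ⟨fun e => if h : e ∈ D then c ⟨e, h⟩ else 0, fun d hd => ?_, ?_⟩
    · simpa [hd] using hc.1 ⟨d, hd⟩
    · rw [← Finset.sum_coe_sort]
      simp [φ]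
  refine hsub (hbox.isClosed.closure_subset ?_)
  refine closure_mono ?_ (mem_closure_iff_nhds.2 fun t ht => ?_ :
    x ∈ closure (finiteCone D ∩ Metric.ball x 1))
  · rintro r ⟨hr, hrx⟩
    obtain ⟨c, hc, hcr, hcM⟩ := hM r hr
    refine ⟨fun d => c d, ⟨fun d => hc d d.2, fun d => ?_⟩, ?_⟩
    · have h1 : c d ≤ ∑ d ∈ D, c d := Finset.single_le_sum hc d.2
      have h2 : ‖r‖ ≤ ‖x‖ + 1 := by
        have := norm_le_norm_add_norm_sub' r x
        rw [mem_ball_iff_norm] at hrx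
        linarith
      exact h1.trans (hcM.trans (mul_le_mul_of_nonneg_left h2 hM0))
    · rw [← hcr, ← Finset.sum_coe_sort]
  · obtain ⟨y, hy⟩ := mem_closure_iff_nhds.1 hx _
      (Filter.inter_mem ht (Metric.ball_mem_nhds x one_pos))
    exact ⟨y, hy.1.1, hy.2, hy.1.2⟩

end Cone

/-! ### Active sets, faces and elementary bounds on the pyramidal width. -/

section Width

variable {H : Type*} [NormedAddCommGroup H] [InnerProductSpace ℝ H]

theorem IsActiveSet.nonempty {S : Finset H} {x : H} (h : IsActiveSet S x) : S.Nonempty := by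
  obtain ⟨w, -, h1, -⟩ := h
  by_contra hS
  rw [Finset.not_nonempty_iff_eq_empty] at hS
  simp [hS] at h1

/-- A linear functional averages over an active set. -/
theorem IsActiveSet.exists_sum_inner {S : Finset H} {x : H} (h : IsActiveSet S x) :
    ∃ w : H → ℝ, (∀ s ∈ S, 0 < w s) ∧ ∀ r : H, ∀ a : ℝ,
      ∑ s ∈ S, w s * (inner ℝ r s - a) = inner ℝ r x - a := by
  obtain ⟨w, h0, h1, rfl⟩ := h
  refine ⟨w, h0, fun r a => ?_⟩
  simp only [mul_sub, Finset.sum_sub_distrib, ← Finset.sum_mul, h1, one_mul, inner_sum,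
    inner_smul_right]

/-- A linear functional that is bounded on an active set of `x` by its value at `x` is constant
there. -/
theorem IsActiveSet.inner_eq {S : Finset H} {x : H} (h : IsActiveSet S x) {r : H}
    (hr : ∀ s ∈ S, inner ℝ r s ≤ inner ℝ r x) : ∀ s ∈ S, inner ℝ r s = inner ℝ r x := by
  obtain ⟨w, h0, hw⟩ := h.exists_sum_inner
  have h2 := hw r (inner ℝ r x)
  rw [sub_self, Finset.sum_eq_zero_iff_of_nonpos fun s hs =>
    mul_nonpos_of_nonneg_of_nonpos (h0 s hs).le (sub_nonpos.2 (hr s hs))] at h2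
  intro s hs
  rcases mul_eq_zero.1 (h2 s hs) with h | h
  · exact absurd h (h0 s hs).ne'
  · exact sub_eq_zero.1 h

theorem exists_isActiveSet {B : Set H} {x : H} (hx : x ∈ convexHull ℝ B) :
    ∃ S : Finset H, (S : Set H) ⊆ B ∧ IsActiveSet S x := by
  classical
  rw [convexHull_eq_union_convexHull_finite_subsets] at hx
  simp only [Set.mem_iUnion] at hx
  obtain ⟨T, hT, hx⟩ := hx
  obtain ⟨w, h0, h1, h2⟩ := Finset.mem_convexHull'.1 hx
  refine ⟨T.filter fun s => w s ≠ 0, fun s hs => hT (Finset.mem_filter.1 hs).1, w,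
    fun s hs => ?_, ?_, ?_⟩
  · obtain ⟨hs, hs'⟩ := Finset.mem_filter.1 hs
    exact lt_of_le_of_ne (h0 s hs) (Ne.symm hs')
  · rw [Finset.sum_filter_ne_zero, h1]
  · rw [← h2]
    refine Finset.sum_filter_of_ne fun s _ h hw => h ?_
    rw [hw, zero_smul]

/-- A proper convex combination that lies in an extreme set has its atoms there. -/
theorem activeSet_subset_of_isExtreme {C K : Set H} (hC : Convex ℝ C) (hK : IsExtreme ℝ C K)
    {S : Finset H} {x : H} (hSC : (S : Set H) ⊆ C) (hS : IsActiveSet S x) (hx : x ∈ K) :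
    (S : Set H) ⊆ K := by
  classical
  obtain ⟨w, h0, h1, h2⟩ := hS
  intro s hs
  have hs : s ∈ S := hs
  rw [← Finset.add_sum_erase S _ hs] at h1 h2
  rcases (S.erase s).eq_empty_or_nonempty with he | hne
  · rw [he, Finset.sum_empty, add_zero] at h1 h2
    rw [h1, one_smul] at h2
    rwa [h2]
  have hpos : 0 < ∑ v ∈ S.erase s, w v :=
    Finset.sum_pos (fun v hv => h0 v (Finset.mem_of_mem_erase hv)) hne
  -- `x` lies in the open segment between `s` and the center of mass of the other atoms, so
  -- extremality puts `s` in `K`.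
  have hy : (S.erase s).centerMass w id ∈ C := hC.centerMass_mem
    (fun v hv => (h0 v (Finset.mem_of_mem_erase hv)).le) hpos
    (fun v hv => hSC (Finset.mem_of_mem_erase hv))
  refine hK.left_mem_of_mem_openSegment (hSC hs) hy hx
    ⟨w s, ∑ v ∈ S.erase s, w v, h0 s hs, hpos, h1, ?_⟩
  rw [Finset.centerMass, smul_smul, mul_inv_cancel₀ hpos.ne', one_smul]
  exact h2

theorem IsFace.exists_isActiveSet {A K : Set H} (hK : IsFace (convexHull ℝ A) K) {x : H}
    (hx : x ∈ K) : ∃ S : Finset H, (S : Set H) ⊆ K ∩ A ∧ IsActiveSet S x := by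
  obtain ⟨S, hSA, hS⟩ := _root_.NormCorrective.exists_isActiveSet (hK.1.subset hx)
  exact ⟨S, Set.subset_inter (activeSet_subset_of_isExtreme (convex_convexHull ℝ A) hK.1
    (hSA.trans (subset_convexHull ℝ A)) hS hx) hSA, hS⟩

theorem isFace_self {C : Set H} (hC : Convex ℝ C) : IsFace C C :=
  ⟨IsExtreme.refl ℝ C, hC⟩

/-- The face of a convex set exposed by a linear functional. -/
theorem isFace_exposed {C : Set H} (hC : Convex ℝ C) (n : H) (a : ℝ)
    (h : ∀ y ∈ C, inner ℝ n y ≤ a) : IsFace C {y ∈ C | inner ℝ n y = a} := by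
  refine ⟨⟨Set.sep_subset _ _, ?_⟩, ?_⟩
  · rintro x hx y hy z ⟨-, hz⟩ ⟨α, β, hα, hβ, hαβ, rfl⟩
    refine ⟨hx, ?_⟩
    rw [inner_add_right, inner_smul_right, inner_smul_right] at hz
    have h1 := h x hx
    have h2 := h y hy
    by_contra hne
    have h3 : inner ℝ n x < a := lt_of_le_of_ne h1 hne
    have h4 := mul_lt_mul_of_pos_left h3 hα
    have h5 := mul_le_mul_of_nonneg_left h2 hβ.le
    have h6 : α * a + β * a = a := by rw [← add_mul, hαβ, one_mul]
    linarith
  · rintro x ⟨hx, hxa⟩ y ⟨hy, hya⟩ α β hα hβ hαβ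
    refine ⟨hC hx hy hα hβ hαβ, ?_⟩
    rw [inner_add_right, inner_smul_right, inner_smul_right, hxa, hya, ← add_mul, hαβ, one_mul]

/-- The choice `s = v` contributes `0`, and an unbounded supremum is `0` by convention. This
supplies the lower bounds required for the infima in the width. -/
theorem sSup_inner_nonneg {B : Set H} {S : Finset H} {r x : H} (hSB : (S : Set H) ⊆ B)
    (hS : IsActiveSet S x) :
    0 ≤ sSup {d : ℝ | ∃ s ∈ B, ∃ v ∈ S, d = inner ℝ (‖r‖⁻¹ • r) (s - v)} := by
  obtain ⟨v, hv⟩ := hS.nonempty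
  exact Real.sSup_nonneg' ⟨0, ⟨v, hSB hv, v, hv, by simp⟩, le_rfl⟩

theorem pdirW_nonneg (B : Set H) (r x : H) : 0 ≤ pdirW B r x := by
  refine Real.sInf_nonneg ?_
  rintro _ ⟨S, hSB, hS, rfl⟩
  exact sSup_inner_nonneg hSB hS

theorem pyramidalWidth_nonneg (A : Set H) : 0 ≤ pyramidalWidth A := by
  refine Real.sInf_nonneg ?_
  rintro _ ⟨K, -, x, -, y, -, c, -, r, -, -, rfl⟩
  exact pdirW_nonneg _ _ _

theorem pdirW_le {B : Set H} {S : Finset H} {r x : H} {M : ℝ} (hSB : (S : Set H) ⊆ B)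
    (hS : IsActiveSet S x) (hM : ∀ s ∈ B, ∀ v ∈ S, inner ℝ r (s - v) ≤ M) :
    pdirW B r x ≤ ‖r‖⁻¹ * M := by
  have h1 : pdirW B r x ≤
      sSup {d : ℝ | ∃ s ∈ B, ∃ v ∈ S, d = inner ℝ (‖r‖⁻¹ • r) (s - v)} := by
    refine csInf_le ⟨0, ?_⟩ ⟨S, hSB, hS, rfl⟩
    rintro _ ⟨S, hSB, hS, rfl⟩
    exact sSup_inner_nonneg hSB hS
  refine h1.trans ?_
  obtain ⟨v, hv⟩ := hS.nonempty
  refine csSup_le ⟨0, v, hSB hv, v, hv, by simp⟩ ?_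
  rintro _ ⟨s, hs, v, hv, rfl⟩
  rw [real_inner_smul_left]
  exact mul_le_mul_of_nonneg_left (hM s hs v hv) (by positivity)

/-- The pyramidal width bounds from below the width in every feasible direction of a face. -/
theorem pyramidalWidth_mul_norm_le {A K : Set H} (hK : IsFace (convexHull ℝ A) K) {x y : H}
    (hx : x ∈ K) (hy : y ∈ K) {c : ℝ} (hc : 0 ≤ c) {S : Finset H} (hSA : (S : Set H) ⊆ A)
    (hS : IsActiveSet S x) {M : ℝ}
    (hM : ∀ s ∈ K ∩ A, ∀ v ∈ S, inner ℝ (c • (y - x)) (s - v) ≤ M) :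
    pyramidalWidth A * ‖c • (y - x)‖ ≤ M := by
  have hSK : (S : Set H) ⊆ K ∩ A := Set.subset_inter
    (activeSet_subset_of_isExtreme (convex_convexHull ℝ A) hK.1
      (hSA.trans (subset_convexHull ℝ A)) hS hx) hSA
  by_cases hr : c • (y - x) = 0
  · obtain ⟨v, hv⟩ := hS.nonempty
    have := hM v (hSK hv) v hv
    rw [sub_self, inner_zero_right] at this
    simpa [hr] using this
  · have hpos : 0 < ‖c • (y - x)‖ := norm_pos_iff.2 hr
    have h1 : pyramidalWidth A ≤ pdirW (K ∩ A) (c • (y - x)) x := by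
      refine csInf_le ⟨0, ?_⟩ ⟨K, hK, x, hx, y, hy, c, hc, _, rfl, hr, rfl⟩
      rintro _ ⟨K, -, x, -, y, -, c, -, r, -, -, rfl⟩
      exact pdirW_nonneg _ _ _
    replace h1 := h1.trans (pdirW_le hSK hS hM)
    calc pyramidalWidth A * ‖c • (y - x)‖ ≤ ‖c • (y - x)‖⁻¹ * M * ‖c • (y - x)‖ :=
          mul_le_mul_of_nonneg_right h1 hpos.le
      _ = M := by field_simp

theorem nontrivial_of_pyramidalWidth_pos {A : Set H} (h : 0 < pyramidalWidth A) :
    A.Nontrivial := by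
  by_contra hA
  rw [Set.not_nontrivial_iff] at hA
  have hC : (convexHull ℝ A).Subsingleton := by
    rcases hA.eq_empty_or_singleton with rfl | ⟨a, rfl⟩ <;> simp
  refine h.ne' ?_
  unfold pyramidalWidth
  -- With at most one point there is no nonzero feasible direction, and the infimum of the empty set
  -- is `0` by convention.
  convert Real.sInf_empty
  rw [Set.eq_empty_iff_forall_notMem]
  rintro _ ⟨K, hK, x, hx, y, hy, c, -, r, rfl, hr, -⟩
  exact hr (by rw [hC (hK.1.subset hx) (hK.1.subset hy), sub_self, smul_zero])

theorem isActiveSet_singleton (x : H) : IsActiveSet {x} x :=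
  ⟨fun _ => 1, by simp, by simp, by simp⟩

theorem isActiveSet_pair {a b : H} (hab : a ≠ b) [DecidableEq H] :
    IsActiveSet {a, b} ((1 / 2 : ℝ) • a + (1 / 2 : ℝ) • b) := by
  refine ⟨fun _ => 1 / 2, fun _ _ => by norm_num, ?_, ?_⟩
  · rw [Finset.sum_pair hab]; norm_num
  · rw [Finset.sum_pair hab]

/-- Cauchy–Schwarz at an atom `a`, with active set `{a}`, in the direction of another atom. -/
theorem pyramidalWidth_le_diam {A : Set H} (hA : Bornology.IsBounded A) :
    pyramidalWidth A ≤ Metric.diam A := by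
  rcases (pyramidalWidth_nonneg A).eq_or_lt with h | h
  · rw [← h]
    exact Metric.diam_nonneg
  obtain ⟨a, ha, b, hb, hab⟩ := nontrivial_of_pyramidalWidth_pos h
  have hab' : 0 < ‖b - a‖ := norm_pos_iff.2 (sub_ne_zero.2 hab.symm)
  have h1 := pyramidalWidth_mul_norm_le (isFace_self (convex_convexHull ℝ A))
    (subset_convexHull ℝ A ha) (subset_convexHull ℝ A hb) zero_le_one (S := {a})
    (by simpa using ha) (isActiveSet_singleton a) (M := Metric.diam A * ‖b - a‖) (by
      rintro s ⟨-, hs⟩ v hv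
      rw [Finset.mem_singleton] at hv
      rw [hv, one_smul, mul_comm]
      refine (real_inner_le_norm _ _).trans (mul_le_mul_of_nonneg_left ?_ (norm_nonneg _))
      rw [← dist_eq_norm]
      exact Metric.dist_le_diam_of_mem hA hs ha)
  rw [one_smul] at h1
  exact le_of_mul_le_mul_right h1 hab'

end Width

/-! ### Minimal faces, and why positive width forces a polytope. -/

section MinimalFace

variable {H : Type*} [NormedAddCommGroup H] [InnerProductSpace ℝ H]

/-- The smallest face of `C` that contains the point `m` of `C`. -/
def minimalFace (C : Set H) (m : H) : Set H :=
  {z ∈ C | ∃ t : ℝ, 0 < t ∧ m + t • (m - z) ∈ C}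

theorem mem_minimalFace_self {C : Set H} {m : H} (hm : m ∈ C) : m ∈ minimalFace C m :=
  ⟨hm, 1, one_pos, by simpa using hm⟩

theorem add_smul_sub_mem_of_le {C : Set H} (hC : Convex ℝ C) {m z : H} (hm : m ∈ C)
    {t u : ℝ} (hu : 0 < u) (hut : u ≤ t) (h : m + t • (m - z) ∈ C) : m + u • (m - z) ∈ C := by
  have ht : 0 < t := hu.trans_le hut
  convert hC hm h (a := 1 - u / t) (b := u / t) (sub_nonneg.2 ((div_le_one ht).2 hut))
    (by positivity) (by ring) using 1
  rw [smul_add, smul_smul, div_mul_cancel₀ _ ht.ne', sub_smul, one_smul]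
  abel

theorem isFace_minimalFace {C : Set H} (hC : Convex ℝ C) {m : H} (hm : m ∈ C) :
    IsFace C (minimalFace C m) := by
  refine ⟨⟨Set.sep_subset _ _, ?_⟩, ?_⟩
  · rintro x hx y hy z ⟨-, t, ht, hz⟩ ⟨α, β, hα, hβ, hαβ, rfl⟩
    have hpos : 0 < 1 + t * β := by positivity
    refine ⟨hx, t * α / (1 + t * β), by positivity, ?_⟩
    -- Mixing the extension of the segment beyond `m` with `y` cancels the `y`-component, leaving an
    -- extension of the segment from `x` through `m`.
    convert hC hz hy (a := 1 / (1 + t * β)) (b := t * β / (1 + t * β)) (by positivity)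
      (by positivity) (by field_simp) using 1
    have hα' : α = 1 - β := by linarith
    subst hα'
    match_scalars <;> field_simp <;> ring
  · rintro x ⟨hx, t, ht, hxt⟩ y ⟨hy, u, hu, hyu⟩ α β hα hβ hαβ
    refine ⟨hC hx hy hα hβ hαβ, min t u, lt_min ht hu, ?_⟩
    convert hC (add_smul_sub_mem_of_le hC hm (lt_min ht hu) (min_le_left t u) hxt)
      (add_smul_sub_mem_of_le hC hm (lt_min ht hu) (min_le_right t u) hyu) hα hβ hαβ using 1
    have hα' : α = 1 - β := by linarith
    subst hα'
    module

/-- The directions from `m` into its minimal face form a linear subspace. -/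
theorem exists_smul_sub_of_mem_span {C : Set H} (hC : Convex ℝ C) {m : H} (hm : m ∈ C) {d : H}
    (hd : d ∈ Submodule.span ℝ ((fun z => z - m) '' minimalFace C m)) :
    ∃ c : ℝ, 0 ≤ c ∧ ∃ z ∈ minimalFace C m, d = c • (z - m) := by
  have hF := (isFace_minimalFace hC hm).2
  induction hd using Submodule.span_induction with
  | mem d h =>
    obtain ⟨z, hz, rfl⟩ := h
    exact ⟨1, zero_le_one, z, hz, (one_smul _ _).symm⟩
  | zero => exact ⟨0, le_rfl, m, mem_minimalFace_self hm, by simp⟩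
  | add x y _ _ hx hy =>
    obtain ⟨a, ha, z, hz, rfl⟩ := hx
    obtain ⟨b, hb, z', hz', rfl⟩ := hy
    rcases (add_nonneg ha hb).eq_or_lt with h | h
    · have ha0 : a = 0 := by linarith
      have hb0 : b = 0 := by linarith
      exact ⟨0, le_rfl, m, mem_minimalFace_self hm, by simp [ha0, hb0]⟩
    · refine ⟨a + b, h.le, _, hF hz hz' (a := a / (a + b)) (b := b / (a + b)) (by positivity)
        (by positivity) (by field_simp), ?_⟩
      match_scalars <;> field_simp
      ring
  | smul k x _ hx =>
    obtain ⟨a, ha, z, hz, rfl⟩ := hx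
    rcases le_total 0 k with hk | hk
    · exact ⟨k * a, mul_nonneg hk ha, z, hz, by rw [mul_smul]⟩
    · obtain ⟨hzC, t, ht, hzt⟩ := hz
      have hback : m + t⁻¹ • (m - (m + t • (m - z))) ∈ C := by
        convert hzC using 1
        match_scalars
        all_goals field_simp
        all_goals ring
      -- For a negative multiple, `z` is replaced by its reflection `m + t • (m - z)`, which is
      -- again in the minimal face.
      refine ⟨-k * a / t, div_nonneg (mul_nonneg (neg_nonneg.2 hk) ha) ht.le, _,
        ⟨hzt, t⁻¹, inv_pos.2 ht, hback⟩, ?_⟩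
      match_scalars
      all_goals field_simp
      ring

variable [CompleteSpace H]

/-- A point of `A` farthest from some center has distance at least the pyramidal width to every
other point of `A`. -/
theorem pyramidalWidth_le_norm_sub_of_farthest {A : Set H} (hA : Bornology.IsBounded A) {e b c : H}
    (he : e ∈ A) (hb : b ∈ A) (hbe : b ≠ e) (hc : ∀ s ∈ A, ‖s - c‖ ≤ ‖e - c‖) :
    pyramidalWidth A ≤ ‖e - b‖ := by
  classical
  set C := convexHull ℝ A
  have hC : Convex ℝ C := convex_convexHull ℝ A
  set n := e - c with hn
  have hfar : ∀ s ∈ A, inner ℝ n (s - e) ≤ - (1 / 2) * ‖s - e‖ ^ 2 := by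
    intro s hs
    have h1 : s - c = n + (s - e) := by rw [hn]; abel
    have h2 := pow_le_pow_left₀ (norm_nonneg _) (hc s hs) 2
    rw [h1, norm_add_sq_real] at h2
    linarith
  -- The midpoint has active set `{e, b}`, and its feasible directions inside its minimal face form
  -- a subspace, so `n` can be projected onto them orthogonally.
  set m := (1 / 2 : ℝ) • e + (1 / 2 : ℝ) • b with hm_def
  have heC : e ∈ C := subset_convexHull ℝ A he
  have hbC : b ∈ C := subset_convexHull ℝ A hb
  have hm : m ∈ C := hC heC hbC (by norm_num) (by norm_num) (by norm_num)
  set F := minimalFace C m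
  have heF : e ∈ F := ⟨heC, 1, one_pos, by convert hbC using 1; rw [hm_def]; module⟩
  have hbF : b ∈ F := ⟨hbC, 1, one_pos, by convert heC using 1; rw [hm_def]; module⟩
  set W := Submodule.span ℝ ((fun z => z - m) '' F)
  -- `W` need not be closed, so the projection is taken onto the closure and the width bound is
  -- carried there by continuity.
  set V := W.topologicalClosure
  have hFV : ∀ s ∈ F, ∀ v ∈ F, s - v ∈ V := fun s hs v hv => by
    refine W.le_topologicalClosure ?_
    rw [← sub_sub_sub_cancel_right s v m]
    exact W.sub_mem (Submodule.subset_span ⟨s, hs, rfl⟩) (Submodule.subset_span ⟨v, hv, rfl⟩)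
  set p := V.starProjection n
  have hp : ∀ x ∈ V, inner ℝ p x = inner ℝ n x := fun x hx => by
    have := V.starProjection_inner_eq_zero n x hx
    rw [inner_sub_left] at this
    linarith
  have hbound : ∀ d ∈ V, pyramidalWidth A * ‖d‖ ≤ ‖d - p‖ * Metric.diam A + ‖p‖ * ‖e - b‖ := by
    have hcl : IsClosed {d : H |
        pyramidalWidth A * ‖d‖ ≤ ‖d - p‖ * Metric.diam A + ‖p‖ * ‖e - b‖} :=
      isClosed_le (by fun_prop) (by fun_prop)
    refine fun d hd => closure_minimal (fun d hd => ?_) hcl hd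
    obtain ⟨k, hk, z, hz, rfl⟩ := exists_smul_sub_of_mem_span hC hm hd
    refine pyramidalWidth_mul_norm_le (isFace_minimalFace hC hm) (mem_minimalFace_self hm) hz hk
      (S := {e, b}) ?_ (isActiveSet_pair hbe.symm) ?_
    · simp [Set.insert_subset_iff, he, hb]
    · rintro s ⟨hsF, hsA⟩ v hv
      have hv' : v ∈ F ∧ v ∈ A ∧ ‖e - v‖ ≤ ‖e - b‖ := by
        rw [Finset.mem_insert, Finset.mem_singleton] at hv
        rcases hv with rfl | rfl
        · exact ⟨heF, he, by simp⟩
        · exact ⟨hbF, hb, le_rfl⟩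
      obtain ⟨hvF, hvA, hve⟩ := hv'
      -- Differences of points of `F` do not distinguish `p` from `n`. The middle term is
      -- nonpositive since `e` is farthest from `c`; the first disappears once the direction tends
      -- to `p`.
      have h1 : inner ℝ (k • (z - m)) (s - v) =
          inner ℝ (k • (z - m) - p) (s - v) + inner ℝ n (s - e) + inner ℝ p (e - v) := by
        rw [hp _ (hFV e heF v hvF), add_assoc, ← inner_add_right, sub_add_sub_cancel,
          ← hp _ (hFV s hsF v hvF), inner_sub_left, sub_add_cancel]
      have h2 : inner ℝ (k • (z - m) - p) (s - v) ≤ ‖k • (z - m) - p‖ * Metric.diam A := by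
        refine (real_inner_le_norm _ _).trans (mul_le_mul_of_nonneg_left ?_ (norm_nonneg _))
        rw [← dist_eq_norm]
        exact Metric.dist_le_diam_of_mem hA hsA hvA
      have h3 : inner ℝ n (s - e) ≤ 0 := (hfar s hsA).trans (by nlinarith [sq_nonneg ‖s - e‖])
      have h4 : inner ℝ p (e - v) ≤ ‖p‖ * ‖e - b‖ :=
        (real_inner_le_norm _ _).trans (mul_le_mul_of_nonneg_left hve (norm_nonneg _))
      linarith
  -- `p` pairs with `b - e` as `n` does, and that pairing is strictly negative by `hfar`.
  have hp0 : 0 < ‖p‖ := by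
    rw [norm_pos_iff]
    intro h0
    have h1 := hp _ (hFV b hbF e heF)
    have h2 : 0 < ‖b - e‖ := norm_pos_iff.2 (sub_ne_zero.2 hbe)
    have h3 := hfar b hb
    rw [h0, inner_zero_left] at h1
    rw [← h1] at h3
    nlinarith [pow_pos h2 2]
  have := hbound p (V.starProjection_apply_mem n)
  rw [sub_self, norm_zero, zero_mul, zero_add, mul_comm] at this
  exact le_of_mul_le_mul_left this hp0

/-- A compact set of positive pyramidal width has a polytope as its convex hull. -/
theorem exists_finset_convexHull_eq {A : Set H} (hA : IsCompact A) (hw : 0 < pyramidalWidth A) :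
    ∃ E : Finset H, (E : Set H) ⊆ A ∧ convexHull ℝ (E : Set H) = convexHull ℝ A := by
  set E : Set H := {e ∈ A | ∃ c : H, ∀ s ∈ A, ‖s - c‖ ≤ ‖e - c‖} with hE_def
  have hEA : E ⊆ A := Set.sep_subset _ _
  have hfin : E.Finite := by
    obtain ⟨t, -, htf, ht⟩ := hA.finite_cover_balls (half_pos hw)
    have hex : ∀ e ∈ E, ∃ x ∈ t, e ∈ Metric.ball x (pyramidalWidth A / 2) := fun e he => by
      simpa using ht (hEA he)
    choose! g hgt hg using hex
    -- Two distinct farthest points in one ball of radius `w / 2` would be closer than `w`.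
    refine Set.Finite.of_injOn (f := g) hgt ?_ htf
    intro e he b hb heb
    by_contra hne
    obtain ⟨heA, c, hc⟩ := he
    have h1 := pyramidalWidth_le_norm_sub_of_farthest hA.isBounded heA (hEA hb) (Ne.symm hne) hc
    have h2 := Metric.mem_ball.1 (hg e ⟨heA, c, hc⟩)
    have h3 := Metric.mem_ball.1 (hg b hb)
    rw [← heb] at h3
    have h4 := dist_triangle_right e b (g e)
    rw [dist_eq_norm e b] at h4
    linarith
  refine ⟨hfin.toFinset, by simpa using hEA, ?_⟩
  rw [hfin.coe_toFinset]
  refine (convexHull_mono hEA).antisymm (convexHull_min ?_ (convex_convexHull ℝ E))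
  intro a ha
  by_contra haP
  obtain ⟨f, u, hfa, hfu⟩ := geometric_hahn_banach_point_closed (convex_convexHull ℝ E)
    (hfin.isCompact_convexHull ℝ).isClosed haP
  obtain ⟨R, hR⟩ := hA.isBounded.exists_norm_le
  set g := (InnerProductSpace.toDual ℝ H).symm f
  have hg : ∀ x, inner ℝ g x = f x := fun x => InnerProductSpace.toDual_symm_apply
  -- The center `T • g` is far enough out that comparing squared distances of `e` and `a` would give
  -- `2T(f e - f a) ≤ R²`, whereas separation gives more than `R² + 1`.
  set T : ℝ := (R ^ 2 + 1) / (2 * (u - f a)) with hT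
  have hTpos : 0 < 2 * (u - f a) := by linarith
  obtain ⟨e, he, hmax⟩ := hA.exists_isMaxOn ⟨a, ha⟩
    (f := fun s => ‖s - T • g‖) (by fun_prop)
  have heE : e ∈ E := ⟨he, T • g, fun s hs => hmax hs⟩
  have h1 := pow_le_pow_left₀ (norm_nonneg _) (hmax ha) 2
  have h2 : ∀ x : H, ‖x - T • g‖ ^ 2 = ‖x‖ ^ 2 - 2 * (T * f x) + ‖T • g‖ ^ 2 := fun x => by
    rw [norm_sub_sq_real, inner_smul_right, real_inner_comm, hg]
  simp only [h2] at h1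
  have h3 := hfu e (subset_convexHull ℝ E heE)
  have h4 : ‖e‖ ^ 2 ≤ R ^ 2 := pow_le_pow_left₀ (norm_nonneg _) (hR e he) 2
  have h5 : 0 < T := by positivity
  have h6 : T * (u - f a) < T * (f e - f a) := mul_lt_mul_of_pos_left (by linarith) h5
  have h7 : T * (2 * (u - f a)) = R ^ 2 + 1 := div_mul_cancel₀ _ hTpos.ne'
  nlinarith [sq_nonneg ‖a‖]

end MinimalFace

theorem sum_image_sub {H : Type*} [AddGroup H] [DecidableEq H] (E : Finset H) (x : H) {M : Type*} [AddCommMonoid M]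
    (φ : H → M) : ∑ d ∈ E.image (fun e => e - x), φ d = ∑ e ∈ E, φ (e - x) :=
  Finset.sum_image fun _ _ _ _ h => sub_left_injective h

/-! ### The width bound for arbitrary directions, via Moreau's decomposition. -/

section PyramidalBound

variable {H : Type*} [NormedAddCommGroup H] [InnerProductSpace ℝ H]

/-- The cone of feasible directions of a polytope at one of its points is finitely generated. -/
theorem feasibleCone_eq_finiteCone [DecidableEq H] (E : Finset H) {x : H}
    (hx : x ∈ convexHull ℝ (E : Set H)) :
    {r | ∃ y ∈ convexHull ℝ (E : Set H), ∃ c : ℝ, 0 ≤ c ∧ r = c • (y - x)} =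
      finiteCone (E.image fun e => e - x) := by
  ext r
  constructor
  · rintro ⟨y, hy, c, hc, rfl⟩
    obtain ⟨w, h0, h1, rfl⟩ := Finset.mem_convexHull'.1 hy
    refine ⟨fun d => c * w (d + x), ?_, ?_⟩
    · intro d hd
      obtain ⟨e, he, rfl⟩ := Finset.mem_image.1 hd
      simp only [sub_add_cancel]
      exact mul_nonneg hc (h0 e he)
    · rw [sum_image_sub]
      simp only [sub_add_cancel, smul_sub, mul_smul, Finset.sum_sub_distrib, ← Finset.smul_sum,
        ← Finset.sum_smul, h1, one_smul]
  · rintro ⟨c, hc, rfl⟩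
    rw [sum_image_sub]
    have hc' : ∀ e ∈ E, 0 ≤ c (e - x) := fun e he => hc _ (Finset.mem_image_of_mem _ he)
    rcases (Finset.sum_nonneg hc').eq_or_lt with h | h
    · refine ⟨x, hx, 0, le_rfl, ?_⟩
      rw [zero_smul]
      refine Finset.sum_eq_zero fun e he => ?_
      rw [(Finset.sum_eq_zero_iff_of_nonneg hc').1 h.symm e he, zero_smul]
    · refine ⟨E.centerMass (fun e => c (e - x)) id, Finset.centerMass_mem_convexHull E hc' h
        (fun e he => he), _, h.le, ?_⟩
      rw [smul_sub, Finset.centerMass, smul_smul, mul_inv_cancel₀ h.ne', one_smul,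
        Finset.sum_smul, ← Finset.sum_sub_distrib]
      simp only [id, smul_sub]

variable [CompleteSpace H]

/-- Moreau's decomposition with respect to a closed convex cone. -/
theorem exists_moreau {T : Set H} (hcl : IsClosed T) (hconv : Convex ℝ T) (hne : T.Nonempty)
    (hsmul : ∀ d ∈ T, ∀ c : ℝ, 0 ≤ c → c • d ∈ T) (r : H) :
    ∃ p ∈ T, inner ℝ (r - p) p = 0 ∧ ∀ d ∈ T, inner ℝ (r - p) d ≤ 0 := by
  obtain ⟨p, hp, hmin⟩ := exists_norm_eq_iInf_of_complete_convex hne hcl.isComplete hconv r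
  have hvar := (norm_eq_iInf_iff_real_inner_le_zero hconv hp).1 hmin
  -- The variational inequality is tested at `2 • p` and at `0`, both in the cone.
  have h0 : inner ℝ (r - p) p = 0 := by
    refine le_antisymm ?_ ?_
    · have := hvar _ (hsmul p hp 2 zero_le_two)
      rwa [two_smul, add_sub_cancel_right] at this
    · have := hvar _ (hsmul p hp 0 le_rfl)
      rw [zero_smul, zero_sub, inner_neg_right] at this
      linarith
  refine ⟨p, hp, h0, fun d hd => ?_⟩
  have := hvar d hd
  rwa [inner_sub_right, h0, sub_zero] at this

/-- The pyramidal width compares the width of `A` relative to an active set of `x` in an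
arbitrary direction `r` with the slope of `r` along any feasible direction `y - x`. -/
theorem pyramidalWidth_mul_inner_le {A : Set H} (hA : IsCompact A) {x y r : H}
    (hx : x ∈ convexHull ℝ A) (hy : y ∈ convexHull ℝ A) {S : Finset H} (hSA : (S : Set H) ⊆ A)
    (hS : IsActiveSet S x) {M : ℝ} (hM : ∀ s ∈ A, ∀ v ∈ S, inner ℝ r (s - v) ≤ M) :
    pyramidalWidth A * inner ℝ r (y - x) ≤ ‖y - x‖ * M := by
  classical
  have hM0 : 0 ≤ M := by
    obtain ⟨v, hv⟩ := hS.nonempty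
    simpa using hM v (hSA hv) v hv
  rcases (pyramidalWidth_nonneg A).eq_or_lt with hw | hw
  · rw [← hw, zero_mul]
    positivity
  obtain ⟨E, hEA, hE⟩ := exists_finset_convexHull_eq hA hw
  set C := convexHull ℝ A
  have hC : Convex ℝ C := convex_convexHull ℝ A
  set T : Set H := {r | ∃ y ∈ C, ∃ c : ℝ, 0 ≤ c ∧ r = c • (y - x)} with hT
  have hTE : T = finiteCone (E.image fun e => e - x) := by
    rw [← feasibleCone_eq_finiteCone E (hE ▸ hx), hE]
  have hTconv : Convex ℝ T := by
    rw [hTE]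
    rintro _ ⟨c, hc, rfl⟩ _ ⟨b, hb, rfl⟩ α β hα hβ -
    refine ⟨fun d => α * c d + β * b d, fun d hd => add_nonneg (mul_nonneg hα (hc d hd))
      (mul_nonneg hβ (hb d hd)), ?_⟩
    simp only [add_smul, mul_smul, Finset.sum_add_distrib, Finset.smul_sum]
  obtain ⟨p, ⟨z, hz, c, hc, rfl⟩, hp0, hpol⟩ := exists_moreau (hTE ▸ isClosed_finiteCone _) hTconv
    ⟨0, x, hx, 0, le_rfl, by simp⟩ (by
      rintro _ ⟨y, hy, b, hb, rfl⟩ a ha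
      exact ⟨y, hy, a * b, mul_nonneg ha hb, by rw [mul_smul]⟩) r
  set p := c • (z - x)
  have hmem : ∀ u ∈ C, inner ℝ (r - p) u ≤ inner ℝ (r - p) x := fun u hu => by
    have := hpol (u - x) ⟨u, hu, 1, zero_le_one, (one_smul _ _).symm⟩
    rw [inner_sub_right] at this
    linarith
  have hslope : inner ℝ r (y - x) ≤ ‖p‖ * ‖y - x‖ := by
    have h1 := hpol (y - x) ⟨y, hy, 1, zero_le_one, (one_smul _ _).symm⟩
    rw [inner_sub_left] at h1
    linarith [real_inner_le_norm p (y - x)]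
  have hwidth : pyramidalWidth A * ‖p‖ ≤ M := by
    rcases hc.eq_or_lt with h | h
    · have : p = 0 := by simp only [p, ← h, zero_smul]
      rwa [this, norm_zero, mul_zero]
    have hzK : inner ℝ (r - p) z = inner ℝ (r - p) x := by
      have h1 : c * inner ℝ (r - p) (z - x) = 0 := by rw [← inner_smul_right]; exact hp0
      rw [inner_sub_right] at h1
      linarith [(mul_eq_zero.1 h1).resolve_left h.ne']
    -- `r - p` is maximal over the hull at `x`, hence constant on the active set, which therefore
    -- lies in the exposed face.
    have hvK := hS.inner_eq fun v hv => hmem v (subset_convexHull ℝ A (hSA hv))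
    refine pyramidalWidth_mul_norm_le (isFace_exposed hC (r - p) _ hmem) ⟨hx, rfl⟩ ⟨hz, hzK⟩ hc
      hSA hS ?_
    rintro s ⟨⟨-, hsK⟩, hsA⟩ v hv
    have h1 : inner ℝ (r - p) (s - v) = 0 := by rw [inner_sub_right, hsK, hvK v hv, sub_self]
    rw [inner_sub_left] at h1
    linarith [hM s hsA v hv]
  calc pyramidalWidth A * inner ℝ r (y - x) ≤ pyramidalWidth A * (‖p‖ * ‖y - x‖) :=
        mul_le_mul_of_nonneg_left hslope hw.le
    _ = ‖y - x‖ * (pyramidalWidth A * ‖p‖) := by ring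
    _ ≤ ‖y - x‖ * M := mul_le_mul_of_nonneg_left hwidth (norm_nonneg _)

end PyramidalBound

/-! ### Positive width of finite sets. -/

section Positivity

variable {H : Type*} [NormedAddCommGroup H] [InnerProductSpace ℝ H]

/-- On a finitely generated cone the norm is controlled by the inner products with the
generators. -/
theorem exists_norm_le_inner_of_mem_finiteCone (D : Finset H) :
    ∃ M : ℝ, 0 ≤ M ∧ ∀ r ∈ finiteCone D, ∀ b : ℝ, 0 ≤ b → (∀ d ∈ D, inner ℝ r d ≤ b) →
      ‖r‖ ≤ M * b := by
  obtain ⟨M, hM0, hM⟩ := exists_bounded_coeff D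
  refine ⟨M, hM0, fun r hr b hb hrb => ?_⟩
  obtain ⟨c, hc, hcr, hcM⟩ := hM r hr
  rcases (norm_nonneg r).eq_or_lt with h | h
  · rw [← h]; positivity
  have h1 : ‖r‖ ^ 2 ≤ (∑ d ∈ D, c d) * b := by
    rw [← real_inner_self_eq_norm_sq]
    nth_rewrite 2 [← hcr]
    rw [inner_sum, Finset.sum_mul]
    refine Finset.sum_le_sum fun d hd => ?_
    rw [inner_smul_right]
    exact mul_le_mul_of_nonneg_left (hrb d hd) (hc d hd)
  have h2 : ‖r‖ * ‖r‖ ≤ M * b * ‖r‖ := by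
    nlinarith [mul_le_mul_of_nonneg_right hcM hb]
  exact le_of_mul_le_mul_right h2 h

/-- The directions from a point with active set `S` into the convex hull of `B ⊇ S` are conic
combinations of the differences `s - v` with `s ∈ B` and `v ∈ S`. -/
theorem smul_sub_mem_finiteCone [DecidableEq H] {B S : Finset H} {x y : H}
    (hx : IsActiveSet S x) (hy : IsActiveSet B y) {c : ℝ} (hc : 0 ≤ c) :
    c • (y - x) ∈ finiteCone ((B ×ˢ S).image fun q => q.1 - q.2) := by
  obtain ⟨w, hw0, hw1, rfl⟩ := hx
  obtain ⟨u, hu0, hu1, rfl⟩ := hy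
  -- `y - x` is the combination of the differences `s - v` with product weights; pairs with equal
  -- difference are grouped together.
  refine ⟨fun d => ∑ q ∈ (B ×ˢ S).filter (fun q => q.1 - q.2 = d), c * (u q.1 * w q.2),
    fun d _ => Finset.sum_nonneg fun q hq => ?_, ?_⟩
  · obtain ⟨hq1, hq2⟩ := Finset.mem_product.1 (Finset.mem_filter.1 hq).1
    exact mul_nonneg hc (mul_nonneg (hu0 _ hq1).le (hw0 _ hq2).le)
  · have h1 : ∀ d ∈ (B ×ˢ S).image (fun q => q.1 - q.2),
        (∑ q ∈ (B ×ˢ S).filter (fun q => q.1 - q.2 = d), c * (u q.1 * w q.2)) • d =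
          ∑ q ∈ (B ×ˢ S).filter (fun q => q.1 - q.2 = d),
            (c * (u q.1 * w q.2)) • (q.1 - q.2) := fun d _ => by
      rw [Finset.sum_smul]
      exact Finset.sum_congr rfl fun q hq => by rw [(Finset.mem_filter.1 hq).2]
    rw [Finset.sum_congr rfl h1, Finset.sum_fiberwise_of_maps_to
      (fun q hq => Finset.mem_image_of_mem _ hq) (fun q : H × H =>
        (c * (u q.1 * w q.2)) • (q.1 - q.2)), Finset.sum_product]
    simp only [mul_smul, ← Finset.smul_sum, smul_sub, Finset.sum_sub_distrib]
    simp only [← Finset.sum_smul, hw1, hu1, one_smul]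

/-- A unit feasible direction is a conic combination of differences `s - v`, so its norm is at most
a constant times the largest of its inner products with them. Only finitely many sets of differences
occur, and `R` dominates all their constants; the `+ 1` keeps the bound positive. -/
theorem pyramidalWidth_pos {A : Set H} (hA : A.Finite) (hnt : A.Nontrivial) :
    0 < pyramidalWidth A := by
  classical
  set G : Finset H := hA.toFinset
  choose M hM0 hM using exists_norm_le_inner_of_mem_finiteCone (H := H)
  set R : ℝ := ∑ D ∈ ((G ×ˢ G).image fun q => q.1 - q.2).powerset, M D with hR
  have hR0 : 0 ≤ R := Finset.sum_nonneg fun D _ => hM0 D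
  refine lt_of_lt_of_le (by positivity : 0 < (R + 1)⁻¹) ?_
  refine le_csInf ?_ ?_
  · obtain ⟨a, ha, b, hb, hab⟩ := hnt
    exact ⟨_, _, isFace_self (convex_convexHull ℝ A), a, subset_convexHull ℝ A ha, b,
      subset_convexHull ℝ A hb, 1, zero_le_one, _, rfl,
      by rw [one_smul]; exact sub_ne_zero.2 hab.symm, rfl⟩
  rintro _ ⟨K, hK, x, hx, y, hy, c, hc, r, hrc, hr, rfl⟩
  refine le_csInf ?_ ?_
  · obtain ⟨S, hSB, hS⟩ := hK.exists_isActiveSet hx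
    exact ⟨_, S, hSB, hS, rfl⟩
  rintro _ ⟨S, hSB, hS, rfl⟩
  obtain ⟨B, hB, hBy⟩ := hK.exists_isActiveSet hy
  set m := sSup {d : ℝ | ∃ s ∈ K ∩ A, ∃ v ∈ S, d = inner ℝ (‖r‖⁻¹ • r) (s - v)} with hm
  have hm0 : 0 ≤ m := sSup_inner_nonneg hSB hS
  have hrpos : 0 < ‖r‖ := norm_pos_iff.2 hr
  set D : Finset H := (B ×ˢ S).image fun q => q.1 - q.2 with hD
  have hDG : D ∈ ((G ×ˢ G).image fun q => q.1 - q.2).powerset := by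
    rw [Finset.mem_powerset]
    refine Finset.image_subset_image (Finset.product_subset_product ?_ ?_)
    · exact fun s hs => hA.mem_toFinset.2 (hB hs).2
    · exact fun s hs => hA.mem_toFinset.2 (hSB hs).2
  have hbdd : BddAbove {d : ℝ | ∃ s ∈ K ∩ A, ∃ v ∈ S, d = inner ℝ (‖r‖⁻¹ • r) (s - v)} := by
    refine Set.Finite.bddAbove (((hA.inter_of_right K).prod S.finite_toSet).image
      (fun q : H × H => inner ℝ (‖r‖⁻¹ • r) (q.1 - q.2)) |>.subset ?_)
    rintro _ ⟨s, hs, v, hv, rfl⟩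
    exact ⟨(s, v), ⟨hs, hv⟩, rfl⟩
  have h1 : ‖‖r‖⁻¹ • r‖ ≤ M D * m := by
    refine hM D _ ?_ m hm0 ?_
    · rw [hrc, smul_smul]
      exact smul_sub_mem_finiteCone hS hBy (by positivity)
    · intro d hd
      obtain ⟨q, hq, rfl⟩ := Finset.mem_image.1 hd
      obtain ⟨hq1, hq2⟩ := Finset.mem_product.1 hq
      exact le_csSup hbdd ⟨q.1, hB hq1, q.2, hq2, rfl⟩
  rw [norm_smul, norm_inv, norm_norm, inv_mul_cancel₀ hrpos.ne'] at h1
  have h2 : M D ≤ R := Finset.single_le_sum (f := M) (fun D _ => hM0 D) hDG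
  rw [inv_le_iff_one_le_mul₀ (by positivity)]
  nlinarith [mul_le_mul_of_nonneg_right h2 hm0]

end Positivity

/-! ### Sign of the rate constant. -/

section Rate

variable {H : Type*} [NormedAddCommGroup H] [InnerProductSpace ℝ H]

theorem rate_nonneg {A : Set H} {L μ δ : ℝ} (hL : 0 < L) (hμ : 0 < μ) : 0 ≤ rate A L μ δ := by
  unfold rate
  positivity

theorem rate_pos {A : Set H} (hA : Bornology.IsBounded A) {L μ δ : ℝ} (hL : 0 < L) (hμ : 0 < μ)
    (hδ : 0 < δ) (hw : 0 < pyramidalWidth A) : 0 < rate A L μ δ := by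
  have := hw.trans_le (pyramidalWidth_le_diam hA)
  unfold rate
  positivity

end Rate

/-! ### First-order inequalities and the one-step decrease. -/

section Descent

variable {H : Type*} [NormedAddCommGroup H] [InnerProductSpace ℝ H] [CompleteSpace H]

theorem hasDerivAt_comp_segment {f : H → ℝ} {x : H} (hf : DifferentiableAt ℝ f x) (d : H) :
    HasDerivAt (fun t : ℝ => f (x + t • d)) (inner ℝ (gradient f x) d) 0 := by
  have h1 : HasFDerivAt f (InnerProductSpace.toDual ℝ H (gradient f x)) (x + (0 : ℝ) • d) := by
    simpa using hf.hasGradientAt.hasFDerivAt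
  have h2 : HasDerivAt (fun t : ℝ => x + t • d) d 0 := by
    simpa using ((hasDerivAt_id (0 : ℝ)).smul_const d).const_add x
  exact h1.comp_hasDerivAt (0 : ℝ) h2

/-- The first order lower bound of a strongly convex function. -/
theorem add_inner_gradient_le_of_strongConvexOn {C : Set H} {μ : ℝ} {f : H → ℝ}
    (hf : StrongConvexOn C μ f) {x y : H} (hx : x ∈ C) (hy : y ∈ C)
    (hd : DifferentiableAt ℝ f x) :
    f x + inner ℝ (gradient f x) (y - x) + μ / 2 * ‖y - x‖ ^ 2 ≤ f y := by
  have h1 := (hasDerivAt_comp_segment hd (y - x)).tendsto_slope_zero_right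
  have h2 : Filter.Tendsto (fun t : ℝ => f y - f x - (1 - t) * (μ / 2 * ‖y - x‖ ^ 2))
      (nhdsWithin 0 (Set.Ioi 0)) (nhds (f y - f x - (1 - 0) * (μ / 2 * ‖y - x‖ ^ 2))) :=
    (Continuous.tendsto (by fun_prop) 0).mono_left nhdsWithin_le_nhds
  -- Strong convexity along the segment is divided by `t`, and `t` tends to `0` from the right.
  have h3 := le_of_tendsto_of_tendsto h1 h2 (by
    filter_upwards [Ioo_mem_nhdsGT (zero_lt_one' ℝ)] with t ht
    have h4 := hf.2 hy hx ht.1.le (sub_nonneg.2 ht.2.le) (by ring)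
    have h5 : t • y + (1 - t) • x = x + t • (y - x) := by module
    rw [h5] at h4
    simp only [zero_add, zero_smul, add_zero, smul_eq_mul] at h4 ⊢
    rw [inv_mul_le_iff₀ ht.1]
    linarith)
  linarith

/-- First order optimality over a convex set. -/
theorem inner_gradient_nonneg_of_isMinOn {C : Set H} (hC : Convex ℝ C) {f : H → ℝ} {x y : H}
    (hx : x ∈ C) (hy : y ∈ C) (hd : DifferentiableAt ℝ f x) (hmin : IsMinOn f C x) :
    0 ≤ inner ℝ (gradient f x) (y - x) := by
  refine ge_of_tendsto (hasDerivAt_comp_segment hd (y - x)).tendsto_slope_zero_right ?_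
  filter_upwards [Ioo_mem_nhdsGT (zero_lt_one' ℝ)] with t ht
  have h1 : x + t • (y - x) ∈ C := hC.add_smul_sub_mem hx hy ⟨ht.1.le, ht.2.le⟩
  have h2 : f x ≤ f (x + t • (y - x)) := hmin h1
  simp only [zero_add, zero_smul, add_zero, smul_eq_mul]
  exact mul_nonneg (inv_nonneg.2 ht.1.le) (sub_nonneg.2 h2)

/-- The lower and upper quadratic bounds at `x` are compared at a second point. -/
theorem strongConvexity_le_smoothness {C : Set H} {L μ : ℝ} {f : H → ℝ}
    (hs : IsSmoothOver L f C) (hc : StrongConvexOn C μ f) (hC : C.Nontrivial) : μ ≤ L := by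
  obtain ⟨x, hx, y, hy, hxy⟩ := hC
  have h1 := add_inner_gradient_le_of_strongConvexOn hc hx hy (hs.1 x hx)
  have h2 := hs.2 x hx y hy
  have h3 : 0 < ‖y - x‖ ^ 2 := pow_pos (norm_pos_iff.2 (sub_ne_zero.2 hxy.symm)) 2
  have h4 : μ * ‖y - x‖ ^ 2 ≤ L * ‖y - x‖ ^ 2 := by linarith
  exact le_of_mul_le_mul_right h4 h3

theorem rate_le_one {A : Set H} (hA : Bornology.IsBounded A) {f : H → ℝ} {L μ δ : ℝ} (hL : 0 < L)
    (hμ : 0 < μ) (hδ : δ ∈ Set.Ioc (0 : ℝ) 1) (hs : IsSmoothOver L f (convexHull ℝ A))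
    (hc : StrongConvexOn (convexHull ℝ A) μ f) : rate A L μ δ ≤ 1 := by
  rcases (pyramidalWidth_nonneg A).eq_or_lt with hw | hw
  · simp [rate, ← hw]
  have hle := pyramidalWidth_le_diam hA
  have hD := hw.trans_le hle
  have hμL := strongConvexity_le_smoothness hs hc
    ((nontrivial_of_pyramidalWidth_pos hw).mono (subset_convexHull ℝ A))
  have h1 : μ * pyramidalWidth A ^ 2 / (L * Metric.diam A ^ 2) ≤ 1 := by
    rw [div_le_one (by positivity)]
    gcongr
  have h2 : δ ^ 2 ≤ 1 := pow_le_one₀ hδ.1.le hδ.2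
  unfold rate
  exact mul_le_one₀ h2 (by positivity) h1

/-- A sufficient condition for the geometric decrease: along a segment whose slope `G` dominates
the width of `A` relative to an active set of `q`, the next iterate does at least as well as the
quadratic upper bound, for all step sizes in `[0, 1]`. -/
theorem sub_le_rate_mul_of_progress {A : Set H} (hA : IsCompact A) {f : H → ℝ} {L μ δ : ℝ}
    (hL : 0 < L) (hμ : 0 < μ) (hδ : δ ∈ Set.Ioc (0 : ℝ) 1)
    (hs : IsSmoothOver L f (convexHull ℝ A)) (hc : StrongConvexOn (convexHull ℝ A) μ f)
    {q q' qstar : H} (hq : q ∈ convexHull ℝ A) (hqs : qstar ∈ convexHull ℝ A)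
    {B : Finset H} (hBA : (B : Set H) ⊆ A) (hB : IsActiveSet B q) {G : ℝ}
    (hG : ∀ s ∈ A, ∀ v ∈ B, δ * inner ℝ (-gradient f q) (s - v) ≤ G)
    (hprog : ∀ γ : ℝ, 0 ≤ γ → γ ≤ 1 →
      f q' ≤ f q - γ * G + L / 2 * (γ ^ 2 * Metric.diam A ^ 2)) :
    f q' - f qstar ≤ (1 - rate A L μ δ) * (f q - f qstar) := by
  set w := pyramidalWidth A with hw_def
  set D := Metric.diam A with hD_def
  set ρ := ‖qstar - q‖ with hρ
  set a := inner ℝ (-gradient f q) (qstar - q) with ha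
  have hδ0 : 0 < δ := hδ.1
  have hkey : w * a ≤ ρ * (G / δ) := pyramidalWidth_mul_inner_le hA hq hqs hBA hB
    fun s hs v hv => by rw [le_div_iff₀ hδ0, mul_comm]; exact hG s hs v hv
  have hstrong := add_inner_gradient_le_of_strongConvexOn hc hq hqs (hs.1 q hq)
  have heps : f q - f qstar ≤ a - μ / 2 * ρ ^ 2 := by
    rw [ha, inner_neg_left]
    linarith
  rcases (pyramidalWidth_nonneg A).eq_or_lt with hw | hw
  · have := hprog 0 le_rfl zero_le_one
    have hr : rate A L μ δ = 0 := by simp [rate, ← hw]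
    rw [hr]
    linarith
  have hwD : w ≤ D := pyramidalWidth_le_diam hA.isBounded
  have hD : 0 < D := hw.trans_le hwD
  have hμL := strongConvexity_le_smoothness hs hc
    ((nontrivial_of_pyramidalWidth_pos hw).mono (subset_convexHull ℝ A))
  have hρD : ρ ≤ D := by
    rw [hρ, ← dist_eq_norm, hD_def, ← convexHull_diam A]
    exact Metric.dist_le_diam_of_mem (isBounded_convexHull.2 hA.isBounded) hqs hq
  have hρ0 : 0 ≤ ρ := norm_nonneg _
  -- With this step size the quadratic loss equals `β μρ²/2` and the linear gain is at least `β a`.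
  -- It is at most `1` because `δ ≤ 1`, `μ ≤ L`, `w ≤ D` and `ρ ≤ D`.
  set γ := δ * μ * w * ρ / (L * D ^ 2) with hγ
  have hγ1 : γ ≤ 1 := by
    rw [hγ, div_le_one (by positivity)]
    calc δ * μ * w * ρ ≤ 1 * L * D * D := by
          gcongr
          exact hδ.2
      _ = L * D ^ 2 := by ring
  have hγ0 : 0 ≤ γ := by positivity
  have h1 := hprog γ hγ0 hγ1
  have h2 : rate A L μ δ * a ≤ γ * G := by
    calc rate A L μ δ * a = δ ^ 2 * μ * w / (L * D ^ 2) * (w * a) := by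
          unfold rate; ring
      _ ≤ δ ^ 2 * μ * w / (L * D ^ 2) * (ρ * (G / δ)) :=
          mul_le_mul_of_nonneg_left hkey (by positivity)
      _ = γ * G := by rw [hγ]; field_simp
  have h3 : L / 2 * (γ ^ 2 * D ^ 2) = rate A L μ δ * (μ / 2 * ρ ^ 2) := by
    rw [hγ, rate, ← hw_def, ← hD_def]
    field_simp
  have h4 := mul_le_mul_of_nonneg_left heps (rate_nonneg hL hμ : 0 ≤ rate A L μ δ)
  rw [h3] at h1
  linarith

/-- One step of the fully corrective variant, from a minimizer over the convex hull of the
collected atoms. -/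
theorem sub_le_rate_mul_of_fullUpdate {A : Set H} (hA : IsCompact A) {f : H → ℝ} {L μ δ : ℝ}
    (hL : 0 < L) (hμ : 0 < μ) (hδ : δ ∈ Set.Ioc (0 : ℝ) 1)
    (hs : IsSmoothOver L f (convexHull ℝ A)) (hc : StrongConvexOn (convexHull ℝ A) μ f)
    {q q' qstar z : H} (hqs : qstar ∈ convexHull ℝ A) {S : Set H} (hSA : S ⊆ A)
    (hq : q ∈ convexHull ℝ S) (hmin : IsMinOn f (convexHull ℝ S) q)
    (hz : IsApproxLMO A δ (gradient f q) q z) (hq' : FullUpdate f (S ∪ {z}) q q') :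
    f q' - f qstar ≤ (1 - rate A L μ δ) * (f q - f qstar) := by
  obtain ⟨B, hBS, hB⟩ := exists_isActiveSet hq
  have hqA : q ∈ convexHull ℝ A := convexHull_mono hSA hq
  have hd := hs.1 q hqA
  -- First-order optimality of `q` over `conv S` makes the gradient constant on the active atoms, so
  -- no away atom is needed.
  have hflat : ∀ v ∈ B, inner ℝ (-gradient f q) v = inner ℝ (-gradient f q) q :=
    hB.inner_eq fun v hv => by
      have := inner_gradient_nonneg_of_isMinOn (convex_convexHull ℝ S) hq
        (subset_convexHull ℝ S (hBS hv)) hd hmin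
      rw [inner_sub_right] at this
      rw [inner_neg_left, inner_neg_left]
      linarith
  refine sub_le_rate_mul_of_progress hA hL hμ hδ hs hc hqA hqs (hBS.trans hSA) hB
    (G := inner ℝ (-gradient f q) (z - q)) (fun s hs v hv => ?_) (fun γ h0 h1 => ?_)
  · rw [inner_sub_right, hflat v hv, ← inner_sub_right, inner_neg_left, inner_neg_left]
    linarith [hz.2 s hs]
  · have hzA : z ∈ convexHull ℝ A := subset_convexHull ℝ A hz.1
    have hy := (convex_convexHull ℝ A).add_smul_sub_mem hqA hzA ⟨h0, h1⟩
    have hyS : q + γ • (z - q) ∈ convexHull ℝ (S ∪ {z}) :=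
      (convex_convexHull ℝ _).add_smul_sub_mem (convexHull_mono Set.subset_union_left hq)
        (subset_convexHull ℝ _ (Or.inr (Set.mem_singleton z))) ⟨h0, h1⟩
    have h2 : f q' ≤ f (q + γ • (z - q)) := hq'.2 hyS
    have h3 := hs.2 q hqA _ hy
    have h4 : ‖z - q‖ ^ 2 ≤ Metric.diam A ^ 2 := by
      refine pow_le_pow_left₀ (norm_nonneg _) ?_ 2
      rw [← dist_eq_norm, ← convexHull_diam A]
      exact Metric.dist_le_diam_of_mem (isBounded_convexHull.2 hA.isBounded) hzA hqA
    rw [add_sub_cancel_left, inner_smul_right, norm_smul, mul_pow, Real.norm_eq_abs, sq_abs] at h3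
    have h5 : L / 2 * (γ ^ 2 * ‖z - q‖ ^ 2) ≤ L / 2 * (γ ^ 2 * Metric.diam A ^ 2) := by gcongr
    rw [inner_neg_left]
    linarith

/-- A point closest to `q - (1 / L) • g` in a convex set satisfies the variational inequality of
the quadratic model of slope `g` at `q`. -/
theorem NormUpdate.inner_nonneg {f : H → ℝ} {L : ℝ} (hL : 0 < L) {S : Set H} {q q' y : H}
    (h : NormUpdate f L S q q') (hy : y ∈ convexHull ℝ S) :
    0 ≤ inner ℝ (gradient f q + L • (q' - q)) (y - q') := by
  obtain ⟨hq', hmin⟩ := h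
  set b := q - (1 / L) • gradient f q with hb
  have hne : Nonempty (convexHull ℝ S) := ⟨⟨q', hq'⟩⟩
  have hinf : ‖b - q'‖ = ⨅ u : convexHull ℝ S, ‖b - u‖ := by
    refine le_antisymm (le_ciInf fun u => ?_)
      (ciInf_le ⟨0, by rintro _ ⟨u, rfl⟩; positivity⟩ (⟨q', hq'⟩ : convexHull ℝ S))
    have h1 : ‖q' - b‖ ^ 2 ≤ ‖(u : H) - b‖ ^ 2 := hmin u.2
    rw [norm_sub_rev b, norm_sub_rev b]
    exact (sq_le_sq₀ (norm_nonneg _) (norm_nonneg _)).1 h1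
  have h2 := (norm_eq_iInf_iff_real_inner_le_zero (convex_convexHull ℝ S) hq').1 hinf y hy
  have h3 : gradient f q + L • (q' - q) = -(L • (b - q')) := by
    rw [hb]
    match_scalars <;> field_simp
  rw [h3, inner_neg_left, real_inner_smul_left]
  nlinarith

/-- A good step of the norm-corrective variant. -/
theorem sub_le_rate_mul_of_normUpdate {A : Set H} (hA : IsCompact A) {f : H → ℝ} {L μ δ : ℝ}
    (hL : 0 < L) (hμ : 0 < μ) (hδ : δ ∈ Set.Ioc (0 : ℝ) 1)
    (hs : IsSmoothOver L f (convexHull ℝ A)) (hc : StrongConvexOn (convexHull ℝ A) μ f)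
    {q q' qstar z : H} (hqs : qstar ∈ convexHull ℝ A) {S : Set H} (hSA : S ⊆ A)
    (hq : q ∈ convexHull ℝ S) (hz : IsApproxLMO A δ (gradient f q) q z)
    (hq' : NormUpdate f L (S ∪ {z}) q q') (hgood : IsGoodStep f S (S ∪ {z}) q q') :
    f q' - f qstar ≤ (1 - rate A L μ δ) * (f q - f qstar) := by
  obtain ⟨B, B', hB, hB', hB'S, U, hBU, hUS, v, hvU, hvmax, hvB'⟩ := hgood
  set g := gradient f q with hg
  have hS'A : S ∪ {z} ⊆ A := Set.union_subset hSA (by simpa using hz.1)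
  have hqA : q ∈ convexHull ℝ A := convexHull_mono hSA hq
  have hq'A : q' ∈ convexHull ℝ A := convexHull_mono hS'A hq'.1
  have hvA : v ∈ A := hSA (hUS hvU)
  have hBmax : ∀ u ∈ B, inner ℝ g u ≤ inner ℝ g v := fun u hu => hvmax (hBU hu)
  have hqv : inner ℝ g q ≤ inner ℝ g v := by
    obtain ⟨w, hw0, hw⟩ := hB.exists_sum_inner
    have h1 := hw g (inner ℝ g v)
    have h2 : ∑ u ∈ B, w u * (inner ℝ g u - inner ℝ g v) ≤ 0 := Finset.sum_nonpos fun u hu =>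
      mul_nonpos_of_nonneg_of_nonpos (hw0 u hu).le (sub_nonpos.2 (hBmax u hu))
    linarith
  set h := g + L • (q' - q) with hh
  have hvar : ∀ y ∈ convexHull ℝ (S ∪ {z}), 0 ≤ inner ℝ h (y - q') := fun y hy =>
    hq'.inner_nonneg hL hy
  -- The good step enters here: `v` is active in `q'`, so the variational inequality is an equality
  -- at `v`.
  have hvflat : inner ℝ h (v - q') = 0 := by
    have := hB'.inner_eq (r := -h) (fun u hu => by
      have := hvar u (subset_convexHull ℝ _ (hB'S hu))
      rw [inner_sub_right] at this
      rw [inner_neg_left, inner_neg_left]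
      linarith) v hvB'
    rw [inner_neg_left, inner_neg_left] at this
    rw [inner_sub_right]
    linarith
  refine sub_le_rate_mul_of_progress hA hL hμ hδ hs hc hqA hqs (hBU.trans (hUS.trans hSA)) hB
    (G := inner ℝ (-g) (z - v)) (fun s hs u hu => ?_) (fun γ h0 h1 => ?_)
  · have h1 := hz.2 s hs
    have h2 := hBmax u hu
    have h3 := mul_le_mul_of_nonneg_left h2 hδ.1.le
    -- The oracle loses a factor `δ` only on the part `z - q`; since `⟪g, v - q⟫ ≥ 0` and `δ ≤ 1`,
    -- the away part can be scaled by `δ` too.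
    have h4 := mul_le_mul_of_nonneg_right hδ.2 (sub_nonneg.2 hqv)
    simp only [inner_neg_left, inner_sub_right] at h1 ⊢
    linarith
  · have h2 := hs.2 q hqA q' hq'A
    have hqvar := hvar q (convexHull_mono Set.subset_union_left hq)
    have hzvar := mul_nonneg h0 (hvar z (subset_convexHull ℝ _ (Or.inr (Set.mem_singleton z))))
    have hvz : inner ℝ h (z - v) = inner ℝ h (z - q') := by
      rw [← sub_sub_sub_cancel_right z v q', inner_sub_right, hvflat, sub_zero]
    -- `h` is the gradient of the model `⟪g, d⟫ + L‖d‖²/2` at `d = q' - q`. With `h4`, the model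
    -- value there is at most that at `γ • (z - v)`, even if `q + γ • (z - v)` leaves the hull.
    have h3 : 0 ≤ inner ℝ h (γ • (z - v) - (q' - q)) := by
      rw [inner_sub_right, inner_smul_right, hvz, ← neg_sub q q', inner_neg_right]
      linarith
    have h4 : 0 ≤ ‖γ • (z - v) - (q' - q)‖ ^ 2 := sq_nonneg _
    rw [norm_sub_sq_real] at h4
    rw [hh, inner_add_left, real_inner_smul_left, inner_sub_right, inner_smul_right,
      inner_sub_right (q' - q), real_inner_self_eq_norm_sq,
      real_inner_comm (γ • (z - v)) (q' - q)] at h3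
    have h5 : ‖z - v‖ ^ 2 ≤ Metric.diam A ^ 2 := by
      refine pow_le_pow_left₀ (norm_nonneg _) ?_ 2
      rw [← dist_eq_norm]
      exact Metric.dist_le_diam_of_mem hA.isBounded hz.1 hvA
    have h6 : L / 2 * ‖γ • (z - v)‖ ^ 2 ≤ L / 2 * (γ ^ 2 * Metric.diam A ^ 2) := by
      rw [norm_smul, mul_pow, Real.norm_eq_abs, sq_abs]
      gcongr
    have h7 := mul_nonneg (half_pos hL).le h4
    rw [inner_neg_left]
    linarith

end Descent

/-! ### Invariants of a run and the theorem. -/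

section Run

variable {H : Type*} [NormedAddCommGroup H] [InnerProductSpace ℝ H] [CompleteSpace H]
  {update : Set H → H → H → Prop} {f : H → ℝ} {A : Set H} {δ : ℝ} {q z : ℕ → H} {S : ℕ → Set H}

theorem IsRun.atoms_subset (h : IsRun update f A δ q z S) (t : ℕ) : S t ⊆ A := by
  induction t with
  | zero => rw [h.init_atoms]; simpa using h.init_mem
  | succ t ih => rw [h.atoms]; exact Set.union_subset ih (by simpa using (h.oracle t).1)

/-- A property of an atom with its singleton and of all results of updates holds along a run. -/
theorem IsRun.invariant (h : IsRun update f A δ q z S) {P : Set H → H → Prop}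
    (h0 : ∀ x, P {x} x) (hP : ∀ S x y, update S x y → P S y) (t : ℕ) : P (S t) (q t) := by
  cases t with
  | zero => rw [h.init_atoms]; exact h0 _
  | succ t => exact hP _ _ _ (h.step t)

end Run

end NormCorrective

theorem mainTheorem3 {H : Type*} [NormedAddCommGroup H] [InnerProductSpace ℝ H] [CompleteSpace H]
    (A : Set H) (hA : IsCompact A) (f : H → ℝ) (L μ δ : ℝ)
    (hL : 0 < L) (hμ : 0 < μ) (hδ : δ ∈ Set.Ioc (0 : ℝ) 1)
    (hsmooth : NormCorrective.IsSmoothOver L f (convexHull ℝ A))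
    (hconvex : StrongConvexOn (convexHull ℝ A) μ f)
    (qstar : H) (hqstar : qstar ∈ convexHull ℝ A) (hmin : IsMinOn f (convexHull ℝ A) qstar) :
    -- the rate constant
    (NormCorrective.rate A L μ δ ∈ Set.Icc (0 : ℝ) 1 ∧
      (0 < NormCorrective.pyramidalWidth A → 0 < NormCorrective.rate A L μ δ) ∧
      (A.Finite → A.Nontrivial → 0 < NormCorrective.pyramidalWidth A)) ∧
    -- Variant 1: geometric decrease at every step
    (∀ (q z : ℕ → H) (S : ℕ → Set H),
      NormCorrective.IsRun (NormCorrective.FullUpdate f) f A δ q z S →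
      ∀ t : ℕ, f (q (t + 1)) - f qstar ≤
        (1 - NormCorrective.rate A L μ δ) * (f (q t) - f qstar)) ∧
    -- Variant 0: geometric decrease at every good step
    (∀ (q z : ℕ → H) (S : ℕ → Set H),
      NormCorrective.IsRun (NormCorrective.NormUpdate f L) f A δ q z S →
      ∀ t : ℕ, NormCorrective.IsGoodStep f (S t) (S (t + 1)) (q t) (q (t + 1)) →
        f (q (t + 1)) - f qstar ≤
          (1 - NormCorrective.rate A L μ δ) * (f (q t) - f qstar)) := by
  have hb := hA.isBounded
  refine ⟨⟨⟨NormCorrective.rate_nonneg hL hμ,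
    NormCorrective.rate_le_one hb hL hμ hδ hsmooth hconvex⟩,
    NormCorrective.rate_pos hb hL hμ hδ.1, NormCorrective.pyramidalWidth_pos⟩, ?_, ?_⟩
  · intro q z S hrun t
    -- Variant 1 needs the current iterate to be optimal already over its own atoms; at `t = 0` this
    -- is trivial, as the hull is a single point.
    obtain ⟨hq, hqmin⟩ := hrun.invariant
      (P := fun S x => x ∈ convexHull ℝ S ∧ IsMinOn f (convexHull ℝ S) x)
      (fun x => by simp [IsMinOn, IsMinFilter]) (fun _ _ _ h => h) t
    exact NormCorrective.sub_le_rate_mul_of_fullUpdate hA hL hμ hδ hsmooth hconvex hqstar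
      (hrun.atoms_subset t) hq hqmin (hrun.oracle t) (hrun.atoms t ▸ hrun.step t)
  · intro q z S hrun t hgood
    have hq := hrun.invariant (P := fun S x => x ∈ convexHull ℝ S) (fun x => by simp)
      (fun _ _ _ h => h.1) t
    rw [hrun.atoms t] at hgood
    exact NormCorrective.sub_le_rate_mul_of_normUpdate hA hL hμ hδ hsmooth hconvex hqstar
      (hrun.atoms_subset t) hq (hrun.oracle t) (hrun.atoms t ▸ hrun.step t) hgood
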